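/- Let $G$ be a finite simple graph whose edges are colored (arbitrarily; the coloring need not be proper). The color class of a color $c$ used on some edge is the subgraph of $G$ formed by all edges of color $c$ and their endpoints. Suppose that - $G$ has at least one edge; - $G$ is rainbow acyclic: there is no cycle of $G$ all of whose edges have pairwise different colors; - the coloring is a multipartite decomposition: every color class is a complete multipartite graph, that is, its vertex set can be partitioned into nonempty parts so that two of its vertices are adjacent in it if and only if they lie in different parts. Then there is a color class $H$ (with at least one edge), with vertex partition $U_1,\ldots,U_k$ into its parts as a complete multipartite graph, such that removing the edges of $H$ disconnects $U_1,\ldots,U_k$ from each other: for all $i\neq j$, $v\in U_i$ and $w\in U_j$, the vertices $v$ and $w$ are not connected by a path in the graph $G\setminus H$ obtained from $G$ by deleting the edges of $H$. -/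

import Mathlib

/-!
Edge-coloured simple graphs. An edge colouring is an arbitrary assignment of a colour to each
edge (`SimpleGraph.EdgeLabeling`); it is not required to be proper.
-/

namespace RainbowStructure

/-- The colour class of the colour `k`, as the subgraph of `G` induced by the edges of colour `k`.
Its vertices are the endpoints of these edges, so it has no isolated vertices. -/
def colorClass {V K : Type*} {G : SimpleGraph V} (C : G.EdgeLabeling K) (k : K) : G.Subgraph where
  verts := {v | ∃ w, (C.labelGraph k).Adj v w}
  Adj := (C.labelGraph k).Adj
  adj_sub := fun h => C.labelGraph_le h
  edge_vert := fun {_ w} h => ⟨w, h⟩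
  symm := (C.labelGraph k).symm

/-- All edges traversed by the walk have pairwise different colours. -/
def IsRainbow {V K : Type*} {G : SimpleGraph V} (C : G.EdgeLabeling K) {u v : V}
    (p : G.Walk u v) : Prop :=
  (p.darts.map fun d => C ⟨d.edge, d.edge_mem⟩).Nodup

/-- There is no rainbow cycle. -/
def RainbowAcyclic {V K : Type*} {G : SimpleGraph V} (C : G.EdgeLabeling K) : Prop :=
  ∀ (v : V) (p : G.Walk v v), p.IsCycle → ¬ IsRainbow C p

/-- Every colour class is a complete multipartite graph. (For a colour that is not used the class
has no vertices, and the condition is void.) -/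
def IsMultipartiteDecomposition {V K : Type*} {G : SimpleGraph V} (C : G.EdgeLabeling K) : Prop :=
  ∀ k : K, (colorClass C k).coe.IsCompleteMultipartite

/-- `U 0, …, U (n - 1)` is the vertex partition of the complete multipartite graph `H`: these are
nonempty, pairwise disjoint sets with union the vertex set of `H`, and two vertices of `H` are
adjacent in `H` exactly when they lie in different parts. -/
structure IsVertexPartition {V : Type*} {G : SimpleGraph V} (H : G.Subgraph) {n : ℕ}
    (U : Fin n → Set V) : Prop where
  nonempty : ∀ i, (U i).Nonempty
  disjoint : ∀ i j, i ≠ j → Disjoint (U i) (U j)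
  iUnion_eq : ⋃ i, U i = H.verts
  adj_iff : ∀ i j, ∀ v ∈ U i, ∀ w ∈ U j, (H.Adj v w ↔ i ≠ j)

end RainbowStructure

/-! Induct on the number of vertices. If no rainbow walk joins `x` and `y`, identify them:
acyclicity survives (`acyclic_map`), and a colour separating in the quotient separates upstairs.
Quotients may leave simple graphs, hence the abstract systems.

Otherwise all pairs are joined by rainbow walks. Draw an arc from `A` to each colour on a rainbow
walk joining two vertices of one part of `A`. Arcs have no directed cycle (`not_transGen_arc_self`),
so some colour `B` has no incoming arc. Any walk avoiding `B` can then be made rainbow without using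
`B` (`exists_nodup_colorWalk`), so it cannot join the ends of a `B`-edge. -/

/-- A family of symmetric relations on `V`, one for each colour, each of which is complete
multipartite on its support. -/
structure MultipartiteSystem (V K : Type*) where
  Adj : K → V → V → Prop
  symm : ∀ {k x y}, Adj k x y → Adj k y x
  adj_or_adj : ∀ {k x y z w}, Adj k x y → Adj k z w → Adj k x z ∨ Adj k z y

namespace MultipartiteSystem

variable {V K : Type*} (S : MultipartiteSystem V K)

/-- `S.ColorWalk l x y`: some walk from `x` to `y` traverses the colours `l` in this order. -/
inductive ColorWalk : List K → V → V → Prop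
  | nil (x : V) : ColorWalk [] x x
  | cons {k : K} {x y z : V} {l : List K} :
      S.Adj k x y → ColorWalk l y z → ColorWalk (k :: l) x z

/-- There is no closed rainbow walk. -/
def Acyclic : Prop := ∀ (l : List K) (x : V), l ≠ [] → l.Nodup → ¬ S.ColorWalk l x x

/-- `x` and `y` lie in the same part of the colour `k`. -/
def SamePart (k : K) (x y : V) : Prop :=
  (∃ u, S.Adj k x u) ∧ (∃ u, S.Adj k y u) ∧ ¬ S.Adj k x y

/-- A rainbow walk with colours `l` through `B` joins two vertices of one part of `A`. -/
def Via (A : K) (l : List K) (B : K) : Prop :=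
  ∃ x y, S.SamePart A x y ∧ S.ColorWalk l x y ∧ l.Nodup ∧ B ∈ l

/-- Some rainbow walk through `B` joins two vertices of one part of `A`. -/
def Arc (A B : K) : Prop := ∃ l, S.Via A l B

variable {S}

/-! ### Colour walks and parts. -/

theorem ColorWalk.append {l m : List K} {x y z : V} (h : S.ColorWalk l x y)
    (h' : S.ColorWalk m y z) : S.ColorWalk (l ++ m) x z := by
  induction h with
  | nil => exact h'
  | cons e _ ih => exact .cons e (ih h')

theorem colorWalk_append {l m : List K} {x z : V} :
    S.ColorWalk (l ++ m) x z ↔ ∃ y, S.ColorWalk l x y ∧ S.ColorWalk m y z := by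
  refine ⟨fun h => ?_, fun ⟨y, h, h'⟩ => h.append h'⟩
  induction l generalizing x with
  | nil => exact ⟨x, .nil x, h⟩
  | cons k l ih =>
    cases h with
    | cons e h =>
      obtain ⟨y, h1, h2⟩ := ih h
      exact ⟨y, .cons e h1, h2⟩

theorem colorWalk_cons {k : K} {l : List K} {x z : V} :
    S.ColorWalk (k :: l) x z ↔ ∃ y, S.Adj k x y ∧ S.ColorWalk l y z :=
  ⟨fun h => by cases h with | cons e h => exact ⟨_, e, h⟩, fun ⟨_, e, h⟩ => .cons e h⟩

theorem colorWalk_nil {x y : V} : S.ColorWalk [] x y ↔ x = y :=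
  ⟨fun h => by cases h; rfl, fun h => h ▸ .nil x⟩

theorem ColorWalk.reverse {l : List K} {x y : V} (h : S.ColorWalk l x y) :
    S.ColorWalk l.reverse y x := by
  induction h with
  | nil x => exact .nil x
  | cons e _ ih =>
    rw [List.reverse_cons]
    exact ih.append (.cons (S.symm e) (.nil _))

theorem SamePart.adj {k : K} {x y z : V} (h : S.SamePart k x y) (e : S.Adj k x z) :
    S.Adj k y z := by
  obtain ⟨-, ⟨u, hu⟩, hn⟩ := h
  exact (S.adj_or_adj e hu).resolve_left hn

theorem Acyclic.not_adj (hS : S.Acyclic) (k : K) (x : V) : ¬ S.Adj k x x := fun e =>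
  hS [k] x (by simp) (by simp) (.cons e (.nil x))

theorem Acyclic.samePart_refl (hS : S.Acyclic) {k : K} {x u : V} (h : S.Adj k x u) :
    S.SamePart k x x :=
  ⟨⟨u, h⟩, ⟨u, h⟩, hS.not_adj k x⟩

/-- No rainbow walk closes up with an edge of a further colour. -/
theorem Acyclic.not_adj_of_colorWalk (hS : S.Acyclic) {k : K} {l : List K} {x y : V}
    (h : S.ColorWalk l x y) (hl : l.Nodup) (hk : k ∉ l) : ¬ S.Adj k y x := fun e =>
  hS (k :: l) y (by simp) (List.nodup_cons.2 ⟨hk, hl⟩) (.cons e h)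

/-- A rainbow walk between two vertices of one part of `k` avoids `k`. -/
theorem Acyclic.notMem_of_samePart (hS : S.Acyclic) {k : K} {l : List K} {x y : V}
    (hxy : S.SamePart k x y) (h : S.ColorWalk l x y) (hl : l.Nodup) : k ∉ l := by
  intro hk
  obtain ⟨l₁, l₂, rfl⟩ := List.append_of_mem hk
  obtain ⟨a, h₁, h₂⟩ := colorWalk_append.1 h
  obtain ⟨b, e, h₂⟩ := colorWalk_cons.1 h₂
  have hk₁ : k ∉ l₁ := by grind
  have hk₂ : k ∉ l₂ := by grind
  obtain ⟨⟨u, hu⟩, ⟨v, hv⟩, hn⟩ := hxy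
  -- The walk reaches `a` from the part of `x`, and `y` from `b`, without `k`; so both ends of the
  -- `k`-edge `ab` would lie in one part.
  have ha : ¬ S.Adj k a x := hS.not_adj_of_colorWalk h₁ (by grind) hk₁
  have hb : ¬ S.Adj k y b := hS.not_adj_of_colorWalk h₂ (by grind) hk₂
  have hay : S.Adj k a y := (S.adj_or_adj e hv).resolve_right hb
  exact hn ((S.adj_or_adj hay hu).resolve_left ha)

/-- A walk witnessing `S.Via A l C` can be entered through an edge of colour `C` from any vertex
of the colour `C`. -/
theorem Acyclic.exists_colorWalk_of_mem (hS : S.Acyclic) {A C : K} {l : List K} {x y c d : V}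
    (hxy : S.SamePart A x y) (h : S.ColorWalk l x y) (hl : l.Nodup) (hC : C ∈ l)
    (hc : S.Adj C c d) :
    ∃ m z, S.SamePart A x z ∧ S.ColorWalk (C :: m) c z ∧ (C :: m).Nodup ∧ A ∉ C :: m ∧
      m.length < l.length ∧ C :: m ⊆ l := by
  have hA := hS.notMem_of_samePart hxy h hl
  obtain ⟨l₁, l₂, rfl⟩ := List.append_of_mem hC
  obtain ⟨s, h₁, h₂⟩ := colorWalk_append.1 h
  obtain ⟨t, e, h₂⟩ := colorWalk_cons.1 h₂
  rcases S.adj_or_adj e hc with hs | ht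
  · obtain ⟨u, hu⟩ := hxy.1
    refine ⟨l₁.reverse, x, hS.samePart_refl hu, .cons (S.symm hs) h₁.reverse, ?_, ?_, ?_, ?_⟩
    · simp only [List.nodup_cons, List.mem_reverse, List.nodup_reverse]; grind
    · simp only [List.mem_cons, List.mem_reverse]; grind
    · simp only [List.length_reverse, List.length_append, List.length_cons]; omega
    · intro a; simp only [List.mem_cons, List.mem_reverse, List.mem_append]; grind
  · refine ⟨l₂, y, hxy, .cons ht h₂, ?_, ?_, ?_, ?_⟩
    · grind
    · grind
    · simp only [List.length_append, List.length_cons]; omega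
    · intro a; simp only [List.mem_cons, List.mem_append]; grind

theorem _root_.List.exists_first_common {α : Type*} {l m : List α} (h : ¬ l.Disjoint m) :
    ∃ a b c, l = a ++ b :: c ∧ b ∈ m ∧ a.Disjoint m := by
  induction l with
  | nil => simp at h
  | cons k l ih =>
    by_cases hk : k ∈ m
    · exact ⟨[], k, l, rfl, hk, by simp⟩
    · have hl : ¬ l.Disjoint m := fun hd => h (by simpa [List.disjoint_cons_left] using ⟨hk, hd⟩)
      obtain ⟨a, b, c, rfl, hb, ha⟩ := ih hl
      exact ⟨k :: a, b, c, rfl, hb, by simpa [List.disjoint_cons_left] using ⟨hk, ha⟩⟩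

/-! ### The arc relation has no directed cycle. -/

/-- Two rainbow walks joined by an edge of colour `B` with a common colour: the first common
colour `F` of the first one has a rainbow walk through `B` between vertices of one part. -/
theorem Acyclic.exists_via_of_not_disjoint (hS : S.Acyclic) {B : K} {m m' : List K} {t z p w : V}
    (h : S.ColorWalk m t z) (h' : S.ColorWalk m' p w) (e : S.Adj B w t) (hm : m.Nodup)
    (hm' : m'.Nodup) (hB : B ∉ m) (hB' : B ∉ m') (hd : ¬ m.Disjoint m') :
    ∃ F a b c d l, m = a ++ F :: b ∧ m' = c ++ F :: d ∧ a.Disjoint m' ∧ S.Via F l B ∧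
      l.length = a.length + 1 + d.length := by
  obtain ⟨a, F, b, rfl, hF, had⟩ := List.exists_first_common hd
  obtain ⟨c, d, rfl⟩ := List.append_of_mem hF
  obtain ⟨f, h₁, h₂⟩ := colorWalk_append.1 h
  obtain ⟨g, efg, -⟩ := colorWalk_cons.1 h₂
  obtain ⟨j, -, h₃⟩ := colorWalk_append.1 h'
  obtain ⟨i, eji, h₃⟩ := colorWalk_cons.1 h₃
  have hw : S.ColorWalk (a.reverse ++ B :: d.reverse) f i :=
    h₁.reverse.append (.cons (S.symm e) h₃.reverse)
  have hnd : (F :: (a.reverse ++ B :: d.reverse)).Nodup := by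
    have h1 : ∀ x ∈ a, x ∉ d := fun x hx hxd => had hx (by simp [hxd])
    simp only [List.nodup_cons, List.nodup_append, List.mem_append, List.mem_cons,
      List.mem_reverse, List.nodup_reverse] at *
    grind
  obtain ⟨hF₁, hnd⟩ := List.nodup_cons.1 hnd
  refine ⟨F, a, b, c, d, _, rfl, rfl, had, ⟨f, i, ⟨⟨g, efg⟩, ⟨j, S.symm eji⟩, fun hfi => ?_⟩, hw,
    hnd, by simp⟩, by simp; omega⟩
  exact hS.not_adj_of_colorWalk hw hnd hF₁ (S.symm hfi)

/-- Minimal counterexample on total length: the two walks, entered suitably, close up through an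
`A`-edge and a `B`-edge. If they share colours, the first common colour on either side gives a new
opposite pair, and minimality makes the lengths contradictory. -/
theorem Acyclic.not_via_symm (hS : S.Acyclic) (n : ℕ) : ∀ (A B : K) (r q : List K),
    S.Via A r B → S.Via B q A → r.length + q.length = n → False := by
  induction n using Nat.strong_induction_on with
  | _ n ih =>
  intro A B r q hr hq hn
  obtain ⟨x, y, hxy, hrw, hrn, hBr⟩ := id hr
  obtain ⟨u, v, huv, hqw, hqn, hAq⟩ := id hq
  obtain ⟨x', hx'⟩ := hxy.1
  obtain ⟨u', hu'⟩ := huv.1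
  obtain ⟨m, z, hxz, hm, hmn, hAm, hmr, hmsub⟩ := hS.exists_colorWalk_of_mem hxy hrw hrn hBr hu'
  obtain ⟨m', w, huw, hm', hmn', hBm', hmq, hmsub'⟩ :=
    hS.exists_colorWalk_of_mem huv hqw hqn hAq hx'
  obtain ⟨t, et, hm⟩ := colorWalk_cons.1 hm
  obtain ⟨p, ep, hm'⟩ := colorWalk_cons.1 hm'
  have hzp := hxz.adj ep
  have hwt := huw.adj et
  simp only [List.nodup_cons, List.mem_cons, not_or] at hmn hmn' hAm hBm'
  by_cases hd : m.Disjoint m'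
  · refine hS.not_adj_of_colorWalk (hm.append (.cons hzp hm')) ?_ ?_ hwt
    · rw [List.nodup_append]
      refine ⟨hmn.2, List.nodup_cons.2 hmn', ?_⟩
      rintro a ha b hb rfl
      rcases List.mem_cons.1 hb with rfl | hb
      · exact hAm.2 ha
      · exact hd ha hb
    · simp only [List.mem_append, List.mem_cons]
      tauto
  · have hd' : ¬ m'.Disjoint m := fun h => hd h.symm
    obtain ⟨F, a, b, c, d, l, h1, h2, had, hl, hlen⟩ :=
      hS.exists_via_of_not_disjoint hm hm' hwt hmn.2 hmn'.2 hmn.1 hBm'.2 hd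
    obtain ⟨G, a', b', c', d', l', h1', h2', had', hl', hlen'⟩ :=
      hS.exists_via_of_not_disjoint hm' hm hzp hmn'.2 hmn.2 hmn'.1 hAm.2 hd'
    have hBF : S.Via B q F := ⟨u, v, huv, hqw, hqn, hmsub' (by simp [h2])⟩
    have hAG : S.Via A r G := ⟨x, y, hxy, hrw, hrn, hmsub (by simp [h2'])⟩
    have e1 : ¬ l.length + q.length < n := fun hlt => ih _ hlt F B l q hl hBF rfl
    have e2 : ¬ r.length + l'.length < n := fun hlt => ih _ hlt A G r l' hAG hl' rfl
    -- No common colour precedes the first one, so `G` cannot occur within `a`.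
    have key : ∀ {a b c d m m' : List K} {F G : K}, m = a ++ F :: b → m = c ++ G :: d →
        a.Disjoint m' → G ∈ m' → a.length ≤ c.length := by
      intro a b c d m m' F G h1 h2 had hG
      by_contra! hlt
      have hpre : c ++ [G] <+: a := by
        refine List.prefix_of_prefix_length_le (l₃ := m) ⟨d, by simp [h2]⟩ ⟨F :: b, h1.symm⟩ ?_
        simpa using hlt
      exact had (hpre.subset (by simp)) hG
    have e3 := key h1 h2' had (by simp [h1'])
    have e4 := key h1' h2 had' (by simp [h1])
    have f1 := congrArg List.length h1
    have f2 := congrArg List.length h2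
    have f3 := congrArg List.length h1'
    have f4 := congrArg List.length h2'
    simp only [List.length_append, List.length_cons] at f1 f2 f3 f4
    omega

theorem Acyclic.not_arc_symm (hS : S.Acyclic) {A B : K} (h : S.Arc A B) : ¬ S.Arc B A := by
  obtain ⟨r, hr⟩ := h
  rintro ⟨q, hq⟩
  exact hS.not_via_symm _ A B r q hr hq rfl

/-- The target vertex `a` is fixed while the start `c` is arbitrary in `C`; this is what lets walks
for successive arcs be spliced. -/
theorem Acyclic.exists_colorWalk_of_transGen (hS : S.Acyclic) {A C : K}
    (h : Relation.TransGen S.Arc A C) :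
    ∃ a u, S.Adj A a u ∧ ∀ c d, S.Adj C c d →
      ∃ l y, S.SamePart A a y ∧ S.ColorWalk (C :: l) c y ∧ (C :: l).Nodup := by
  induction h with
  | single h =>
    obtain ⟨l, x, y, hxy, hw, hn, hC⟩ := h
    obtain ⟨x', hx'⟩ := hxy.1
    refine ⟨x, x', hx', fun c d hcd => ?_⟩
    obtain ⟨m, z, hxz, hm, hmn, -⟩ := hS.exists_colorWalk_of_mem hxy hw hn hC hcd
    exact ⟨m, z, hxz, hm, hmn⟩
  | @tail C F _ hCF ih =>
    obtain ⟨a, u, hau, ih⟩ := ih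
    refine ⟨a, u, hau, fun f d hfd => ?_⟩
    obtain ⟨r, x, y, hxy, hw, hn, hF⟩ := hCF
    obtain ⟨x', hx'⟩ := hxy.1
    obtain ⟨l₂, y₂, hxy₂, hl₂, hn₂, hC₂, -, hsub⟩ := hS.exists_colorWalk_of_mem hxy hw hn hF hfd
    obtain ⟨l₁, y₁, hay₁, hl₁, hn₁⟩ := ih x x' hx'
    obtain ⟨t, et, hl₁⟩ := colorWalk_cons.1 hl₁
    have e := hxy₂.adj et
    rw [List.nodup_cons] at hn₁
    -- A shared colour would yield some `H` with arcs both to and from `C`.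
    have hdis : (F :: l₂).Disjoint l₁ := by
      by_contra hd
      obtain ⟨H, a', b, c, d, l, h1, -, -, hvia, -⟩ :=
        hS.exists_via_of_not_disjoint hl₂.reverse hl₁.reverse (S.symm e) (List.nodup_reverse.2 hn₂)
          (List.nodup_reverse.2 hn₁.2) (fun h => hC₂ (List.mem_reverse.1 h))
          (fun h => hn₁.1 (List.mem_reverse.1 h))
          (fun h => hd fun z hz hz' => h (List.mem_reverse.2 hz) (List.mem_reverse.2 hz'))
      have hH : H ∈ F :: l₂ := List.mem_reverse.1 (by simp [h1])
      exact hS.not_arc_symm ⟨l, hvia⟩ ⟨r, x, y, hxy, hw, hn, hsub hH⟩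
    refine ⟨l₂ ++ C :: l₁, y₁, hay₁, hl₂.append (.cons e hl₁), ?_⟩
    rw [← List.cons_append, List.nodup_append]
    refine ⟨hn₂, List.nodup_cons.2 hn₁, ?_⟩
    rintro a ha b hb rfl
    rcases List.mem_cons.1 hb with rfl | hb
    · exact hC₂ ha
    · exact hdis ha hb

theorem Acyclic.not_transGen_arc_self (hS : S.Acyclic) (A : K) :
    ¬ Relation.TransGen S.Arc A A := by
  intro h
  obtain ⟨a, u, hau, H⟩ := hS.exists_colorWalk_of_transGen h
  obtain ⟨l, y, hay, hl, hn⟩ := H a u hau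
  obtain ⟨t, et, hl⟩ := colorWalk_cons.1 hl
  rw [List.nodup_cons] at hn
  exact hS.not_adj_of_colorWalk hl hn.2 hn.1 (hay.adj et)

/-! ### Making walks rainbow. -/

theorem _root_.List.exists_duplicate_split {α : Type*} {l : List α} (h : ¬ l.Nodup) :
    ∃ a k b c, l = a ++ k :: (b ++ k :: c) := by
  induction l with
  | nil => simp at h
  | cons k l ih =>
    by_cases hk : k ∈ l
    · obtain ⟨b, c, rfl⟩ := List.append_of_mem hk
      exact ⟨[], k, b, c, rfl⟩
    · obtain ⟨a, k', b, c, rfl⟩ := ih fun hl => h (List.nodup_cons.2 ⟨hk, hl⟩)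
      exact ⟨k :: a, k', b, c, rfl⟩

/-- If any two vertices are joined by a rainbow walk and no arc enters `B`, then walks avoiding `B`
can be replaced by rainbow walks avoiding `B`. -/
theorem Acyclic.exists_nodup_colorWalk [Finite K] (hS : S.Acyclic)
    (hsat : ∀ x y, ∃ l : List K, l.Nodup ∧ S.ColorWalk l x y) {B : K} (hB : ∀ A, ¬ S.Arc A B)
    {l : List K} {x y : V} (h : S.ColorWalk l x y) (hl : B ∉ l) :
    ∃ m, m.Nodup ∧ B ∉ m ∧ S.ColorWalk m x y := by
  -- Heads of arcs are smaller, so replacing copies of `A` by colours it has arcs to decreases the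
  -- multiset of colours.
  let _ : PartialOrder K :=
    { le := fun a b => a = b ∨ Relation.TransGen S.Arc b a
      lt := fun a b => Relation.TransGen S.Arc b a
      le_refl := fun a => Or.inl rfl
      le_trans := by
        rintro a b c (rfl | h) (rfl | h')
        · exact Or.inl rfl
        · exact Or.inr h'
        · exact Or.inr h
        · exact Or.inr (h'.trans h)
      le_antisymm := by
        rintro a b (rfl | h) (h' | h')
        · rfl
        · rfl
        · exact h'.symm
        · exact absurd (h.trans h') (hS.not_transGen_arc_self _)
      lt_iff_le_not_ge := by
        intro a b
        refine ⟨fun h => ⟨Or.inr h, ?_⟩, fun ⟨h, h'⟩ => ?_⟩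
        · rintro (rfl | h')
          · exact hS.not_transGen_arc_self _ h
          · exact hS.not_transGen_arc_self _ (h.trans h')
        · rcases h with rfl | h
          · exact absurd (Or.inl rfl) h'
          · exact h }
  have hwf := Multiset.wellFounded_isDershowitzMannaLT (α := K)
  induction hM : (l : Multiset K) using hwf.induction generalizing l with
  | _ M ih =>
  subst hM
  by_cases hn : l.Nodup
  · exact ⟨l, hn, hl, h⟩
  obtain ⟨p, A, q, s, rfl⟩ := List.exists_duplicate_split hn
  obtain ⟨a, hp, h⟩ := colorWalk_append.1 h
  obtain ⟨b, eab, h⟩ := colorWalk_cons.1 h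
  obtain ⟨c, hq, h⟩ := colorWalk_append.1 h
  obtain ⟨d, ecd, hs⟩ := colorWalk_cons.1 h
  simp only [List.mem_append, List.mem_cons, not_or] at hl
  -- Either one `A`-edge shortcuts the stretch between two occurrences of `A`, or its ends share a
  -- part of `A` and a rainbow walk replaces it.
  by_cases had : S.Adj A a d
  · refine ih _ ?_ (hp.append (.cons had hs)) (by simp; tauto) rfl
    refine ⟨(p : Multiset K) + (A ::ₘ (s : Multiset K)), 0, (A ::ₘ (q : Multiset K)), by simp,
      ?_, ?_, by simp⟩
    · simp
    · simp only [← Multiset.coe_add, ← Multiset.cons_coe, ← Multiset.singleton_add]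
      abel
  · obtain ⟨m, hm, hmw⟩ := hsat a d
    have hvia : ∀ k ∈ m, S.Arc A k := fun k hk =>
      ⟨m, a, d, ⟨⟨b, eab⟩, ⟨c, S.symm ecd⟩, had⟩, hmw, hm, hk⟩
    refine ih _ ?_ (hp.append (hmw.append hs)) ?_ rfl
    · refine ⟨(p : Multiset K) + (s : Multiset K), m, A ::ₘ A ::ₘ (q : Multiset K), by simp,
        ?_, ?_, ?_⟩
      · simp only [← Multiset.coe_add]
        abel
      · simp only [← Multiset.coe_add, ← Multiset.cons_coe, ← Multiset.singleton_add]
        abel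
      · intro k hk
        exact ⟨A, by simp, .single (hvia k hk)⟩
    · simp only [List.mem_append, not_or]
      exact ⟨hl.1, fun hBm => hB A (hvia B hBm), hl.2.2.2.2⟩

/-! ### Identifying vertices and the induction. -/

variable (S) in
/-- The image of a system under a map of vertices. -/
def map {W : Type*} (f : V → W) : MultipartiteSystem W K where
  Adj k a b := ∃ x y, f x = a ∧ f y = b ∧ S.Adj k x y
  symm := fun ⟨x, y, hx, hy, h⟩ => ⟨y, x, hy, hx, S.symm h⟩
  adj_or_adj := by
    rintro k _ _ _ _ ⟨x, y, rfl, rfl, h⟩ ⟨z, w, rfl, rfl, h'⟩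
    rcases S.adj_or_adj h h' with h | h
    · exact Or.inl ⟨x, z, rfl, rfl, h⟩
    · exact Or.inr ⟨z, y, rfl, rfl, h⟩

theorem ColorWalk.map {W : Type*} (f : V → W) {l : List K} {x y : V} (h : S.ColorWalk l x y) :
    (S.map f).ColorWalk l (f x) (f y) := by
  induction h with
  | nil x => exact .nil _
  | cons e _ ih => exact .cons ⟨_, _, rfl, rfl, e⟩ ih

/-- A rainbow walk in the quotient identifying the vertices of `P` lifts to a walk, or to two
walks with a jump within `P`, provided no rainbow walk joins vertices of `P`. -/
theorem exists_lift {W : Type*} {f : V → W} {P : Set V}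
    (hf : ∀ a b, f a = f b → a = b ∨ a ∈ P ∧ b ∈ P)
    (hP : ∀ l : List K, l ≠ [] → l.Nodup → ∀ a ∈ P, ∀ b ∈ P, ¬ S.ColorWalk l a b)
    {l : List K} {p q : W} (h : (S.map f).ColorWalk l p q) (hl : l.Nodup) (hne : l ≠ []) :
    (∃ a b, f a = p ∧ f b = q ∧ S.ColorWalk l a b) ∨
      ∃ l₁ l₂ a b, ∃ z ∈ P, ∃ z' ∈ P, l = l₁ ++ l₂ ∧ l₁ ≠ [] ∧ l₂ ≠ [] ∧ f a = p ∧ f b = q ∧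
        S.ColorWalk l₁ a z ∧ S.ColorWalk l₂ z' b := by
  induction h with
  | nil => exact absurd rfl hne
  | @cons k p p₁ q l e h ih =>
    obtain ⟨a, a₁, rfl, rfl, e⟩ := e
    rw [List.nodup_cons] at hl
    by_cases hle : l = []
    · subst hle
      rw [colorWalk_nil] at h
      exact Or.inl ⟨a, a₁, rfl, h, .cons e (.nil _)⟩
    rcases ih hl.2 hle with ⟨a', b, ha', hb, h'⟩ | ⟨l₁, l₂, a', b, z, hz, z', hz', rfl, h1, h2, ha',
      hb, hw₁, hw₂⟩
    · rcases hf _ _ ha' with rfl | ⟨h1, h2⟩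
      · exact Or.inl ⟨a, b, rfl, hb, .cons e h'⟩
      · exact Or.inr ⟨[k], l, a, b, a₁, h2, a', h1, rfl, by simp, hle, rfl, hb, .cons e (.nil _),
          h'⟩
    · rcases hf _ _ ha' with rfl | ⟨h3, -⟩
      · exact Or.inr ⟨k :: l₁, l₂, a, b, z, hz, z', hz', rfl, by simp, h2, rfl, hb, .cons e hw₁,
          hw₂⟩
      · exact absurd hw₁ (hP l₁ h1 (List.nodup_append.1 hl.2).1 a' h3 z hz)

theorem acyclic_map {W : Type*} {f : V → W} {P : Set V}
    (hS : S.Acyclic) (hf : ∀ a b, f a = f b → a = b ∨ a ∈ P ∧ b ∈ P)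
    (hP : ∀ l : List K, l ≠ [] → l.Nodup → ∀ a ∈ P, ∀ b ∈ P, ¬ S.ColorWalk l a b) :
    (S.map f).Acyclic := by
  intro l p hne hl h
  rcases exists_lift hf hP h hl hne with ⟨a, b, rfl, hb, h⟩ | ⟨l₁, l₂, a, b, z, hz, z', hz', rfl,
    h1, h2, rfl, hb, hw₁, hw₂⟩
  · rcases hf _ _ hb with rfl | ⟨h1, h2⟩
    · exact hS l b hne hl h
    · exact hP l hne hl a h2 b h1 h
  · rcases hf _ _ hb with rfl | ⟨h3, h4⟩
    -- Rotating the closed walk to start at the jump gives a rainbow walk within `P`.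
    · refine hP (l₂ ++ l₁) (by simp [h1]) (List.nodup_append_comm.1 hl) z' hz' z hz
        (hw₂.append hw₁)
    · exact hP l₁ h1 (List.nodup_append.1 hl).1 a h4 z hz hw₁

/-- In an acyclic system some colour class is separated by its own deletion: no walk avoiding the
colour joins two vertices adjacent in it. -/
theorem Acyclic.exists_separating_color [Finite K] [Nonempty K] (n : ℕ) :
    ∀ {V : Type*} [Finite V] {S : MultipartiteSystem V K}, Nat.card V = n → S.Acyclic →
      ∃ B, ∀ x y l, S.Adj B x y → S.ColorWalk l x y → B ∈ l := by
  classical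
  induction n with
  | zero =>
    intro V _ S hV hS
    have : IsEmpty V := Finite.card_eq_zero_iff.1 hV
    exact ⟨Classical.arbitrary K, fun x => isEmptyElim x⟩
  | succ n ih =>
    intro V _ S hV hS
    by_cases hsat : ∀ x y, ∃ l : List K, l.Nodup ∧ S.ColorWalk l x y
    · have : IsTrans K (Relation.TransGen S.Arc) := ⟨fun _ _ _ => Relation.TransGen.trans⟩
      have : Std.Irrefl (Relation.TransGen S.Arc) := ⟨hS.not_transGen_arc_self⟩
      have hwf := Finite.wellFounded_of_trans_of_irrefl (Relation.TransGen S.Arc)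
      obtain ⟨B, -, hB⟩ := hwf.has_min Set.univ Set.univ_nonempty
      refine ⟨B, fun x y l e h => ?_⟩
      by_contra hl
      obtain ⟨m, hm, hBm, hw⟩ :=
        hS.exists_nodup_colorWalk hsat (fun A hA => hB A trivial (.single hA)) h hl
      exact hS.not_adj_of_colorWalk hw hm hBm (S.symm e)
    · push Not at hsat
      obtain ⟨x, y, hxy⟩ := hsat
      have hne : x ≠ y := fun h => hxy [] (by simp) (colorWalk_nil.2 h)
      let f : V → {v // v ≠ y} := fun v => if h : v = y then ⟨x, hne⟩ else ⟨v, h⟩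
      have hf : ∀ a b, f a = f b → a = b ∨ a ∈ ({x, y} : Set V) ∧ b ∈ ({x, y} : Set V) := by
        intro a b hab
        simp only [f] at hab
        simp only [Set.mem_insert_iff, Set.mem_singleton_iff]
        split_ifs at hab <;> grind
      have hS' : (S.map f).Acyclic := by
        refine acyclic_map hS hf ?_
        rintro l hle hl a (rfl | rfl) b (rfl | rfl) hw
        · exact hS l _ hle hl hw
        · exact hxy l hl hw
        · exact hxy l.reverse (List.nodup_reverse.2 hl) hw.reverse
        · exact hS l _ hle hl hw
      have hcard : Nat.card {v // v ≠ y} = n := by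
        have := Fintype.ofFinite V
        rw [Nat.card_eq_fintype_card] at hV ⊢
        rw [Fintype.card_subtype_compl]
        simp [hV]
      obtain ⟨B, hB⟩ := ih hcard hS'
      exact ⟨B, fun a b l e h => hB (f a) (f b) l ⟨a, b, rfl, rfl, e⟩ (h.map f)⟩

end MultipartiteSystem

/-! ### Back to edge-coloured graphs. -/

namespace RainbowStructure

variable {V K : Type*} {G : SimpleGraph V} {C : G.EdgeLabeling K}

/-- The colours of a labelling that occur on some edge. -/
abbrev UsedColor (C : G.EdgeLabeling K) : Type _ := {k : K // ∃ x y, (C.labelGraph k).Adj x y}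

/-- `K` may be infinite; the induction needs finitely many colours. -/
theorem finite_usedColor [Finite V] (C : G.EdgeLabeling K) : Finite (UsedColor C) := by
  refine Finite.of_surjective (α := G.edgeSet)
    (fun e => ⟨C e, ?_⟩) ?_
  · obtain ⟨⟨x, y⟩, he⟩ := e
    exact ⟨x, y, (C.labelGraph_adj x y).2 ⟨he, rfl⟩⟩
  · rintro ⟨k, x, y, h⟩
    obtain ⟨H, rfl⟩ := (C.labelGraph_adj x y).1 h
    exact ⟨⟨s(x, y), H⟩, rfl⟩

/-- The colour classes of a multipartite decomposition. -/
def toSystem (h : IsMultipartiteDecomposition C) : MultipartiteSystem V (UsedColor C) where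
  Adj k x y := (C.labelGraph k.1).Adj x y
  symm := fun h => h.symm
  adj_or_adj := by
    intro k x y z w hxy hzw
    by_contra! hn
    have := (h k.1).trans ⟨x, y, hxy⟩ ⟨z, w, hzw⟩ ⟨y, x, hxy.symm⟩ hn.1 hn.2
    exact this hxy

theorem exists_walk_of_colorWalk (h : IsMultipartiteDecomposition C) {l : List (UsedColor C)}
    {x y : V} (hw : (toSystem h).ColorWalk l x y) :
    ∃ p : G.Walk x y, (p.darts.map fun d => C ⟨d.edge, d.edge_mem⟩) = l.map Subtype.val := by
  induction hw with
  | nil x => exact ⟨.nil, rfl⟩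
  | cons e _ ih =>
    obtain ⟨p, hp⟩ := ih
    obtain ⟨H, hk⟩ := (C.labelGraph_adj _ _).1 e
    refine ⟨.cons H p, ?_⟩
    simp only [SimpleGraph.Walk.darts_cons, List.map_cons, hp, List.cons.injEq, and_true]
    exact hk

theorem IsRainbow.isTrail {x y : V} {p : G.Walk x y} (hp : IsRainbow C p) : p.IsTrail := by
  classical
  refine ⟨List.Nodup.of_map (fun e => if h : e ∈ G.edgeSet then some (C ⟨e, h⟩) else none) ?_⟩
  have : (p.edges.map fun e => if h : e ∈ G.edgeSet then some (C ⟨e, h⟩) else none) =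
      (p.darts.map fun d => C ⟨d.edge, d.edge_mem⟩).map some := by
    simp only [SimpleGraph.Walk.edges, List.map_map]
    refine List.map_congr_left fun d _ => ?_
    simp [d.edge_mem]
  rw [this]
  exact List.Nodup.map (Option.some_injective K) hp

theorem acyclic_toSystem (h : IsMultipartiteDecomposition C) (hC : RainbowAcyclic C) :
    (toSystem h).Acyclic := by
  classical
  intro l x hne hl hw
  obtain ⟨p, hp⟩ := exists_walk_of_colorWalk h hw
  have hr : IsRainbow C p := by
    rw [IsRainbow, hp]
    exact hl.map Subtype.val_injective
  have hnil : p ≠ .nil := by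
    rintro rfl
    exact hne (List.map_eq_nil_iff.1 hp.symm)
  -- A closed rainbow walk may repeat vertices; a cycle extracted from it stays rainbow.
  refine hC x _ (hr.isTrail.isCycle_cycleBypass hnil) ?_
  exact List.Nodup.sublist (p.darts_cycleBypass_sublist_darts.map _) hr

theorem exists_isVertexPartition [Finite V] (h : IsMultipartiteDecomposition C) (k : K) :
    ∃ (n : ℕ) (U : Fin n → Set V), IsVertexPartition (colorClass C k) U := by
  let s := (h k).setoid
  obtain ⟨n, ⟨e⟩⟩ := Finite.exists_equiv_fin (Quotient s)
  refine ⟨n, fun i => {v | ∃ hv : v ∈ (colorClass C k).verts, e ⟦⟨v, hv⟩⟧ = i}, ?_, ?_, ?_, ?_⟩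
  · intro i
    obtain ⟨⟨v, hv⟩, hi⟩ := Quotient.exists_rep (e.symm i)
    exact ⟨v, hv, by rw [hi, e.apply_symm_apply]⟩
  · intro i j hij
    rw [Set.disjoint_left]
    rintro v ⟨hv, rfl⟩ ⟨hv', rfl⟩
    exact hij rfl
  · ext v
    simp
  · rintro i j v ⟨hv, rfl⟩ w ⟨hw, rfl⟩
    rw [ne_eq, e.apply_eq_iff_eq, Quotient.eq]
    exact not_not.symm

theorem exists_colorWalk_of_reachable (h : IsMultipartiteDecomposition C) (k : UsedColor C)
    {x y : V} (hr : (G.deleteEdges (colorClass C k.1).edgeSet).Reachable x y) :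
    ∃ l, k ∉ l ∧ (toSystem h).ColorWalk l x y := by
  obtain ⟨p⟩ := hr
  induction p with
  | nil => exact ⟨[], by simp, .nil _⟩
  | @cons a b c e _ ih =>
    obtain ⟨l, hl, hw⟩ := ih
    rw [SimpleGraph.deleteEdges_adj, SimpleGraph.Subgraph.mem_edgeSet] at e
    obtain ⟨H, hn⟩ := e
    have hadj : (C.labelGraph (C ⟨s(a, b), H⟩)).Adj a b := (C.labelGraph_adj a b).2 ⟨H, rfl⟩
    refine ⟨⟨C ⟨s(a, b), H⟩, a, b, hadj⟩ :: l, ?_, .cons hadj hw⟩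
    rw [List.mem_cons, not_or]
    refine ⟨?_, hl⟩
    rintro rfl
    exact hn hadj

end RainbowStructure

theorem mainTheorem4 {V K : Type*} [Finite V] (G : SimpleGraph V) (C : G.EdgeLabeling K)
    (hedge : G.edgeSet.Nonempty)
    (hacyclic : RainbowStructure.RainbowAcyclic C)
    (hdecomp : RainbowStructure.IsMultipartiteDecomposition C) :
    ∃ k : K, (RainbowStructure.colorClass C k).edgeSet.Nonempty ∧
      ∃ (n : ℕ) (U : Fin n → Set V),
        RainbowStructure.IsVertexPartition (RainbowStructure.colorClass C k) U ∧
        ∀ i j : Fin n, i ≠ j → ∀ v ∈ U i, ∀ w ∈ U j,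
          ¬ (G.deleteEdges (RainbowStructure.colorClass C k).edgeSet).Reachable v w := by
  have := RainbowStructure.finite_usedColor C
  have : Nonempty (RainbowStructure.UsedColor C) := by
    obtain ⟨⟨x, y⟩, he⟩ := hedge
    exact ⟨⟨C ⟨s(x, y), he⟩, x, y, (C.labelGraph_adj x y).2 ⟨he, rfl⟩⟩⟩
  obtain ⟨B, hB⟩ := MultipartiteSystem.Acyclic.exists_separating_color _ rfl
    (RainbowStructure.acyclic_toSystem hdecomp hacyclic)
  obtain ⟨n, U, hU⟩ := RainbowStructure.exists_isVertexPartition hdecomp B.1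
  obtain ⟨x, y, hxy⟩ := B.2
  refine ⟨B.1, ⟨s(x, y), hxy⟩, n, U, hU, fun i j hij v hv w hw hr => ?_⟩
  obtain ⟨l, hl, hwalk⟩ := RainbowStructure.exists_colorWalk_of_reachable hdecomp B hr
  exact hl (hB v w l ((hU.adj_iff i j v hv w hw).2 hij) hwalk)
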